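/- Let $\Lambda$ be an associative ring with unit of finite representation type, that is, $\Lambda$ is left artinian and there are only finitely many finitely generated indecomposable left $\Lambda$-modules up to isomorphism. Let $\{X_1,\dots,X_n\}$ be a complete set of representatives of the isomorphism classes of finitely generated indecomposable left $\Lambda$-modules, let $X=\bigoplus_{i=1}^n X_i$, and let $T=\mathrm{End}_\Lambda(X)$ be the Auslander ring of $\Lambda$, where homomorphisms of left modules are written on the right, so that the product $fg$ in $T$ means "first $f$, then $g$". The socle of a module is multiplicity-free if its composition factors are pairwise non-isomorphic, i.e. if it is a direct sum of pairwise non-isomorphic simple modules. A ring $R$ with unit is semiperfect if $R/J(R)$ is semisimple and idempotents of $R/J(R)$ lift to idempotents of $R$, where $J(R)$ is the Jacobson radical of $R$; $R$ is generalized left QF-2 if it is semiperfect and every indecomposable projective left $R$-module has a multiplicity-free socle. Then the following conditions are equivalent: (a) The Auslander ring $T$ of $\Lambda$ is generalized left QF-2. (b) Every indecomposable left $\Lambda$-module (finitely generated or not) has a multiplicity-free socle. -/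

import Mathlib

open scoped DirectSum

universe u v

/-- A module is indecomposable if it is nonzero and is not the (internal) direct sum of two
nonzero submodules. -/
def IsIndecomposableModule (R : Type u) [Ring R] (M : Type v) [AddCommGroup M] [Module R M] :
    Prop :=
  Nontrivial M ∧ ∀ A B : Submodule R M, IsCompl A B → A = ⊥ ∨ B = ⊥

/-- The socle of a module: the sum of its simple submodules. -/
def moduleSocle (R : Type u) [Ring R] (M : Type v) [AddCommGroup M] [Module R M] :
    Submodule R M :=
  sSup {S : Submodule R M | IsSimpleModule R S}

/-- The socle of `M` is multiplicity-free: its composition factors are pairwise non-isomorphic.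
The socle is semisimple, so its composition factors are the summands in a decomposition into
simple submodules: the condition says that the socle is the (internal) direct sum of a set of
pairwise non-isomorphic simple submodules. -/
def HasMultiplicityFreeSocle (R : Type u) [Ring R] (M : Type v) [AddCommGroup M] [Module R M] :
    Prop :=
  ∃ 𝒮 : Set (Submodule R M),
    (∀ S ∈ 𝒮, IsSimpleModule R S) ∧
    sSupIndep 𝒮 ∧
    sSup 𝒮 = moduleSocle R M ∧
    ∀ S ∈ 𝒮, ∀ S' ∈ 𝒮, Nonempty (S ≃ₗ[R] S') → S = S'

/-- A ring `R` is semiperfect if `R / J(R)` is semisimple, and idempotents of `R / J(R)` lift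
to idempotents of `R`, where `J(R)` is the Jacobson radical. -/
def IsSemiperfectRing (R : Type u) [Ring R] : Prop :=
  IsSemisimpleRing (R ⧸ Ring.jacobson R) ∧
  ∀ e : R ⧸ Ring.jacobson R, IsIdempotentElem e →
    ∃ f : R, IsIdempotentElem f ∧ Ideal.Quotient.mk (Ring.jacobson R) f = e

/-- A (unital) ring is generalized left QF-2 if it is semiperfect and every indecomposable
projective left module over it has a multiplicity-free socle. -/
def IsGeneralizedLeftQF2 (R : Type u) [Ring R] : Prop :=
  IsSemiperfectRing R ∧
  ∀ (P : Type u) [AddCommGroup P] [Module R P],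
    Module.Projective R P → IsIndecomposableModule R P → HasMultiplicityFreeSocle R P

/-- `X 0, …, X (n - 1)` is a complete set of representatives (without repetition) of the
isomorphism classes of finitely generated indecomposable left `Λ`-modules. -/
structure IsCompleteSetOfFGIndecomposables {Λ : Type u} [Ring Λ] {n : ℕ}
    (X : Fin n → ModuleCat.{u} Λ) : Prop where
  finite : ∀ i, Module.Finite Λ (X i)
  indecomposable : ∀ i, IsIndecomposableModule Λ (X i)
  eq_of_iso : ∀ i j, Nonempty (X i ≃ₗ[Λ] X j) → i = j
  exists_iso : ∀ (M : Type u) [AddCommGroup M] [Module Λ M],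
    Module.Finite Λ M → IsIndecomposableModule Λ M → ∃ i, Nonempty (M ≃ₗ[Λ] X i)

/-- A ring is of finite representation type if it is left artinian and has only finitely many
finitely generated indecomposable left modules up to isomorphism. -/
def IsOfFiniteRepresentationType (Λ : Type u) [Ring Λ] : Prop :=
  IsArtinianRing Λ ∧
  ∃ (n : ℕ) (X : Fin n → ModuleCat.{u} Λ), IsCompleteSetOfFGIndecomposables X

/-- The endomorphism ring of `X 0 ⊕ … ⊕ X (n - 1)`. Homomorphisms of left modules are written
on the right, so the product of `f` and `g` is "first `f`, then `g`"; this is the opposite of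
Mathlib's `Module.End`. If `X` is a complete set of representatives of the finitely generated
indecomposable left `Λ`-modules, this is the Auslander ring of `Λ`. -/
abbrev AuslanderRing {Λ : Type u} [Ring Λ] {n : ℕ} (X : Fin n → ModuleCat.{u} Λ) : Type u :=
  (Module.End Λ (⨁ i, X i))ᵐᵒᵖ

/-!
Write `T` for the Auslander ring and `X` for the sum of the `X i`. For every left `Λ`-module `M`,
the group `Hom(X, M)` is a left `T`-module by precomposition. As `Λ` is finitely generated, it is a
direct summand of a power of `X`, so `X` is a generator. Both conditions are compared through the
functor `Hom(X, -)`.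

* A socle is multiplicity-free if and only if any two isomorphic simple submodules are equal
  (`hasMultiplicityFreeSocle_iff`). With this criterion, the socle of `M` is multiplicity-free if
  and only if that of `Hom(X, M)` is (`HasMultiplicityFreeSocle.hom` and
  `HasMultiplicityFreeSocle.of_hom`). This holds although `Hom(X, S)` need not be simple for a
  simple module `S`: it is only used that nonzero modules over `Λ` and over `T` have simple
  submodules.
* `M` is indecomposable if and only if `Hom(X, M)` is (`IsIndecomposableModule.hom` and
  `IsIndecomposableModule.of_hom`).
* The projective `T`-modules are, up to isomorphism, the modules `Hom(X, M)` with `M` an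
  arbitrary `Λ`-module. A projective `T`-module is the image of an idempotent endomorphism of a free
  module, which comes from an idempotent endomorphism of a sum of copies of `X`
  (`exists_linearEquiv_hom_of_projective`). Conversely `Hom(X, M)` is the directed union of the
  modules `Hom(X, A)` with `A ≤ M` finitely generated, and these are projective because `A` is a
  direct summand of a power of `X`; since `T` is semiprimary, `Hom(X, M)` is itself projective, by
  Bass's argument (`IsSemiprimaryRing.projective_of_finset_subset_projective`).

So the indecomposable projective `T`-modules are the modules `Hom(X, M)` with `M` indecomposable, and
the two conditions on socles are equivalent. Here `M` ranges over all modules; whether an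
indecomposable module has to be finitely generated plays no role.

It remains to see that `T` is semiprimary, hence semiperfect (`isSemiprimaryRing_end_directSum`). The
endomorphisms of `X` that have no isomorphism among their components `X i → X j` form an ideal. It is
nilpotent by the Harada–Sai lemma (`eq_zero_or_length_add_le_of_mem_nonIsoComp`), and the quotient by
it is a sum of simple modules, so it is the Jacobson radical.
-/

universe w

/-! ### Multiplicity-free socles -/

section Socle

variable {R : Type*} [Ring R] {M N : Type*} [AddCommGroup M] [Module R M]
  [AddCommGroup N] [Module R N]

/-- The socle is multiplicity-free precisely when no simple module embeds in two different ways,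
that is, with two different images. -/
theorem hasMultiplicityFreeSocle_iff : HasMultiplicityFreeSocle R M ↔
    ∀ S S' : Submodule R M, IsSimpleModule R S → IsSimpleModule R S' →
      Nonempty (S ≃ₗ[R] S') → S = S' := by
  constructor
  · rintro ⟨𝒮, hsimple, -, hsup, hiso⟩
    -- A simple submodule isomorphic to `A ∈ 𝒮` is equal to `A`: otherwise it embeds in `M ⧸ A`,
    -- where the images of the other members of `𝒮` span the image of the socle.
    have key : ∀ S A : Submodule R M, IsSimpleModule R S → A ∈ 𝒮 → Nonempty (S ≃ₗ[R] A) →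
        S = A := by
      intro S A hS hA ⟨eSA⟩
      by_contra hne
      have disj : ∀ B : Submodule R M, IsSimpleModule R B → B ≠ A → Disjoint B A := by
        intro B hB hBA
        exact (isSimpleModule_iff_isAtom.mp hB).disjoint_of_ne
          (isSimpleModule_iff_isAtom.mp (hsimple A hA)) hBA
      have hinj : ∀ B : Submodule R M, IsSimpleModule R B → B ≠ A →
          Function.Injective (A.mkQ.domRestrict B) := by
        intro B hB hBA
        rw [← LinearMap.ker_eq_bot, LinearMap.ker_eq_bot']
        intro b hb
        have hb' : (b : M) ∈ A := by simpa using hb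
        exact Subtype.ext ((Submodule.disjoint_def.mp (disj B hB hBA)) b b.2 hb')
      have emap : ∀ B : Submodule R M, IsSimpleModule R B → B ≠ A →
          Nonempty (B ≃ₗ[R] B.map A.mkQ) := by
        intro B hB hBA
        have e := LinearEquiv.ofInjective _ (hinj B hB hBA)
        exact ⟨e.trans (LinearEquiv.ofEq _ _ (LinearMap.range_domRestrict _ _))⟩
      obtain ⟨eS⟩ := emap S hS hne
      have : IsSimpleModule R (S.map A.mkQ) := IsSimpleModule.congr eS.symm
      have hs : ∀ m : ((fun B : Submodule R M => B.map A.mkQ) '' (𝒮 \ {A}) :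
          Set (Submodule R (M ⧸ A))), IsSimpleModule R m := by
        rintro ⟨_, B, ⟨hB, hBA⟩, rfl⟩
        obtain ⟨eB⟩ := emap B (hsimple B hB) hBA
        have := hsimple B hB
        exact IsSimpleModule.congr eB.symm
      have hle : S.map A.mkQ ≤ sSup ((fun B : Submodule R M => B.map A.mkQ) '' (𝒮 \ {A})) := by
        have h1 : S ≤ sSup 𝒮 := hsup ▸ le_sSup (a := S) hS
        refine (Submodule.map_mono h1).trans ?_
        rw [sSup_eq_iSup, Submodule.map_iSup]
        refine iSup_le fun B => ?_
        rw [Submodule.map_iSup]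
        refine iSup_le fun hB => ?_
        by_cases hBA : B = A
        · rw [hBA, Submodule.mkQ_map_self]; exact bot_le
        · exact le_sSup ⟨B, ⟨hB, hBA⟩, rfl⟩
      obtain ⟨_, ⟨B, ⟨hB, hBA⟩, rfl⟩, ⟨e⟩⟩ := Submodule.linearEquiv_of_le_sSup _ _ hle
      obtain ⟨eB⟩ := emap B (hsimple B hB) hBA
      exact hBA (hiso B hB A hA ⟨((eB.trans e.symm).trans eS.symm).trans eSA⟩)
    intro S S' hS hS' ⟨e⟩
    have hle : S ≤ sSup 𝒮 := hsup ▸ le_sSup (a := S) hS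
    have : ∀ m : 𝒮, IsSimpleModule R m := fun m => hsimple m m.2
    obtain ⟨A, hA, ⟨eA⟩⟩ := Submodule.linearEquiv_of_le_sSup _ _ hle
    rw [key S A hS hA ⟨eA⟩, key S' A hS' hA ⟨e.symm.trans eA⟩]
  · intro h
    refine ⟨{S | IsSimpleModule R S}, fun S hS => hS, ?_, rfl, fun S hS S' hS' e => h S S' hS hS' e⟩
    intro A hA
    have hA : IsSimpleModule R A := hA
    rw [← (isSimpleModule_iff_isAtom.mp hA).not_le_iff_disjoint]
    intro hle
    have : ∀ m : ({S | IsSimpleModule R S} \ {A} : Set (Submodule R M)), IsSimpleModule R m :=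
      fun m => m.2.1
    obtain ⟨B, ⟨hB, hBA⟩, e⟩ := Submodule.linearEquiv_of_le_sSup _ _ hle
    exact hBA (h A B hA hB e).symm

theorem IsSimpleModule.submodule_map {f : M →ₗ[R] N} (hf : Function.Injective f)
    {S : Submodule R M} (hS : IsSimpleModule R S) : IsSimpleModule R (S.map f) :=
  IsSimpleModule.congr (Submodule.equivMapOfInjective f hf S).symm

theorem HasMultiplicityFreeSocle.map_eq_map (h : HasMultiplicityFreeSocle R N)
    {f g : M →ₗ[R] N} (hf : Function.Injective f) (hg : Function.Injective g)
    {S : Submodule R M} (hS : IsSimpleModule R S) : S.map f = S.map g :=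
  hasMultiplicityFreeSocle_iff.mp h _ _ (hS.submodule_map hf) (hS.submodule_map hg)
    ⟨(Submodule.equivMapOfInjective f hf S).symm.trans (Submodule.equivMapOfInjective g hg S)⟩

theorem HasMultiplicityFreeSocle.of_injective (h : HasMultiplicityFreeSocle R N)
    (f : M →ₗ[R] N) (hf : Function.Injective f) : HasMultiplicityFreeSocle R M := by
  rw [hasMultiplicityFreeSocle_iff] at h ⊢
  intro S S' hS hS' ⟨e⟩
  have e1 := Submodule.equivMapOfInjective f hf S
  have e2 := Submodule.equivMapOfInjective f hf S'
  exact Submodule.map_injective_of_injective hf (h (S.map f) (S'.map f)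
    (hS.submodule_map hf) (hS'.submodule_map hf) ⟨(e1.symm.trans e).trans e2⟩)

end Socle

/-! ### Modules over semiprimary rings -/

section Semiprimary

variable {R : Type u} [Ring R]

theorem Submodule.eq_bot_of_le_smul_of_isNilpotent {M : Type*} [AddCommGroup M] [Module R M]
    {I : Ideal R} (hI : IsNilpotent I) {K : Submodule R M} (hK : K ≤ I • K) : K = ⊥ := by
  have : ∀ n : ℕ, K ≤ I ^ n • K := by
    intro n
    induction n with
    | zero => rw [I.pow_zero, Ideal.one_eq_top, Submodule.top_smul]
    | succ n ih =>
      rw [I.pow_succ, Submodule.mul_smul]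
      exact ih.trans (Submodule.smul_mono le_rfl hK)
  obtain ⟨n, hn⟩ := hI
  simpa [hn] using this n

theorem Submodule.eq_top_of_sup_smul_top_of_isNilpotent {M : Type*} [AddCommGroup M] [Module R M]
    {I : Ideal R} (hI : IsNilpotent I) {N : Submodule R M}
    (hN : N ⊔ I • (⊤ : Submodule R M) = ⊤) : N = ⊤ := by
  have : ∀ n : ℕ, N ⊔ I ^ n • (⊤ : Submodule R M) = ⊤ := by
    intro n
    induction n with
    | zero => rw [I.pow_zero, Ideal.one_eq_top, Submodule.top_smul, sup_top_eq]
    | succ n ih =>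
      refine top_le_iff.mp ?_
      calc (⊤ : Submodule R M) = N ⊔ I ^ n • (N ⊔ I • (⊤ : Submodule R M)) := by rw [hN, ih]
        _ ≤ N ⊔ I ^ (n + 1) • (⊤ : Submodule R M) := by
          rw [Submodule.smul_sup, I.pow_succ, Submodule.mul_smul]
          exact sup_le le_sup_left (sup_le (Submodule.smul_le_right.trans le_sup_left) le_sup_right)
  obtain ⟨n, hn⟩ := hI
  simpa [hn] using this n

theorem IsSemiprimaryRing.isSemiperfectRing [IsSemiprimaryRing R] : IsSemiperfectRing R := by
  refine ⟨inferInstance, fun e he => ?_⟩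
  refine exists_isIdempotentElem_eq_of_ker_isNilpotent
    (Ideal.Quotient.mk (Ring.jacobson R)) (fun x hx => ?_) e
    (Ideal.Quotient.mk_surjective e) he
  rw [Ideal.mk_ker] at hx
  obtain ⟨n, hn⟩ := IsSemiprimaryRing.isNilpotent (R := R)
  refine ⟨n, ?_⟩
  have := Ideal.pow_mem_pow hx n
  rwa [hn] at this

theorem IsSemiprimaryRing.exists_isSimpleModule [IsSemiprimaryRing R] (M : Type v)
    [AddCommGroup M] [Module R M] [Nontrivial M] :
    ∃ S : Submodule R M, IsSimpleModule R S := by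
  suffices Nontrivial M → ∃ S : Submodule R M, IsSimpleModule R S from this inferInstance
  refine IsSemiprimaryRing.induction R R M
    (P := fun M => Nontrivial M → ∃ S : Submodule R M, IsSimpleModule R S) ?_ ?_
  · intro M _ _ _ _ _ _ _
    exact IsSemisimpleModule.exists_simple_submodule R M
  · intro M _ _ _ _ N hN hQ hM
    by_cases h : N = ⊥
    · have e := Submodule.quotEquivOfEqBot N h
      obtain ⟨S, hS⟩ := hQ e.toEquiv.nontrivial
      exact ⟨S.map e.toLinearMap, hS.submodule_map e.injective⟩
    · obtain ⟨S, hS⟩ := hN ((Submodule.nontrivial_iff_ne_bot).mpr h)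
      exact ⟨S.map N.subtype, hS.submodule_map N.injective_subtype⟩

theorem isSemisimpleModule_quotient_jacobson_smul_top [IsSemiprimaryRing R] (M : Type*)
    [AddCommGroup M] [Module R M] :
    IsSemisimpleModule R (M ⧸ (Ring.jacobson R • (⊤ : Submodule R M))) := by
  have h : Module.IsTorsionBySet R (M ⧸ (Ring.jacobson R • (⊤ : Submodule R M)))
      (Ring.jacobson R) := by
    rw [Module.isTorsionBySet_quotient_iff]
    exact fun m i hi => Submodule.smul_mem_smul hi trivial
  let _ := h.module
  exact (h.semilinearMap.isSemisimpleModule_iff_of_bijective Function.bijective_id).2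
    inferInstance

theorem LinearMap.smul_top_le_comap {M : Type*} [AddCommGroup M] [Module R M] (I : Ideal R)
    (f : Module.End R M) : I • (⊤ : Submodule R M) ≤ (I • (⊤ : Submodule R M)).comap f := by
  rw [← Submodule.map_le_iff_le_comap, Submodule.map_smul'']
  exact Submodule.smul_mono le_rfl le_top

/-- The ring homomorphism that lets an endomorphism of `M` act on `M ⧸ I M`. -/
def endQuotientSMulTop (M : Type*) [AddCommGroup M] [Module R M] (I : Ideal R) :
    Module.End R M →+* Module.End R (M ⧸ (I • (⊤ : Submodule R M))) where
  toFun f := Submodule.mapQ _ _ f (f.smul_top_le_comap I)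
  map_one' := by ext x; simp
  map_mul' f g := by ext x; simp
  map_zero' := by ext x; simp
  map_add' f g := by ext x; simp

theorem isNilpotent_of_mem_ker_endQuotientSMulTop {M : Type*} [AddCommGroup M] [Module R M]
    {I : Ideal R} (hI : IsNilpotent I) {f : Module.End R M}
    (hf : f ∈ RingHom.ker (endQuotientSMulTop M I)) : IsNilpotent f := by
  have hf' : (⊤ : Submodule R M).map f ≤ I • ⊤ := by
    rintro _ ⟨x, -, rfl⟩
    have := congrArg (fun g => g (Submodule.Quotient.mk x)) ((RingHom.mem_ker).mp hf)
    simpa [endQuotientSMulTop, Submodule.Quotient.mk_eq_zero] using this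
  have : ∀ n : ℕ, (⊤ : Submodule R M).map (f ^ n) ≤ I ^ n • ⊤ := by
    intro n
    induction n with
    | zero => rw [pow_zero, I.pow_zero, Ideal.one_eq_top, Submodule.top_smul]; exact le_top
    | succ n ih =>
      rw [pow_succ', Module.End.mul_eq_comp, Submodule.map_comp, I.pow_succ, Submodule.mul_smul]
      refine (Submodule.map_mono ih).trans ?_
      rw [Submodule.map_smul'']
      exact Submodule.smul_mono le_rfl hf'
  obtain ⟨n, hn⟩ := hI
  refine ⟨n, ?_⟩
  have h := this n
  rw [hn, Submodule.zero_eq_bot, Submodule.bot_smul, le_bot_iff, Submodule.map_top,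
    LinearMap.range_eq_bot] at h
  exact h

/-- Idempotent endomorphisms of `G ⧸ I G` lift to idempotent endomorphisms of `G` if `G` is
projective and `I` is nilpotent. -/
theorem exists_isIdempotentElem_end_lift {G : Type v} [AddCommGroup G] [Module R G]
    [Module.Projective R G] {I : Ideal R} (hI : IsNilpotent I)
    {ebar : Module.End R (G ⧸ (I • (⊤ : Submodule R G)))} (he : IsIdempotentElem ebar) :
    ∃ e : Module.End R G, IsIdempotentElem e ∧
      ∀ x, Submodule.Quotient.mk (e x) = ebar (Submodule.Quotient.mk x) := by
  obtain ⟨e0, he0⟩ := Module.projective_lifting_property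
    (Submodule.mkQ (I • (⊤ : Submodule R G))) (ebar ∘ₗ Submodule.mkQ _)
    (Submodule.mkQ_surjective _)
  have hrange : ebar ∈ RingHom.range (R := Module.End R G) (endQuotientSMulTop G I) := by
    refine ⟨e0, ?_⟩
    refine Submodule.linearMap_qext _ ?_
    rw [← he0]
    rfl
  obtain ⟨e, he, hee⟩ := exists_isIdempotentElem_eq_of_ker_isNilpotent
    (R := Module.End R G) (endQuotientSMulTop G I)
    (fun x hx => isNilpotent_of_mem_ker_endQuotientSMulTop hI hx) ebar hrange he
  exact ⟨e, he, fun x => LinearMap.congr_fun hee (Submodule.Quotient.mk x)⟩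

/-- Modules over a semiprimary ring have projective covers: if `G` is projective and maps onto `F`,
the semisimple module `F ⧸ J F` is a direct summand of `G ⧸ J G`, and the idempotent endomorphism
of `G ⧸ J G` that projects onto it lifts to an idempotent endomorphism of `G`. -/
theorem IsSemiprimaryRing.exists_projective_cover [IsSemiprimaryRing R] {F : Type v} {G : Type w}
    [AddCommGroup F] [Module R F] [AddCommGroup G] [Module R G] [Module.Projective R G]
    (q : G →ₗ[R] F) (hq : Function.Surjective q) :
    ∃ (P : Submodule R G) (π : P →ₗ[R] F), Module.Projective R P ∧
      Function.Surjective π ∧ LinearMap.ker π ≤ Ring.jacobson R • ⊤ := by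
  set J := Ring.jacobson R with hJ
  have hnil : IsNilpotent J := IsSemiprimaryRing.isNilpotent
  have hqJ : J • (⊤ : Submodule R G) ≤ (J • (⊤ : Submodule R F)).comap q := by
    rw [← Submodule.map_le_iff_le_comap, Submodule.map_smul'']
    exact Submodule.smul_mono le_rfl le_top
  let qbar := Submodule.mapQ (J • (⊤ : Submodule R G)) (J • (⊤ : Submodule R F)) q hqJ
  have hqbar : Function.Surjective qbar := by
    intro y
    obtain ⟨y, rfl⟩ := Submodule.mkQ_surjective _ y
    obtain ⟨x, rfl⟩ := hq y
    exact ⟨Submodule.Quotient.mk x, rfl⟩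
  have := isSemisimpleModule_quotient_jacobson_smul_top (R := R) G
  obtain ⟨τ, hτ⟩ := IsSemisimpleModule.lifting_property qbar hqbar LinearMap.id
  have hτ' : ∀ y, qbar (τ y) = y := fun y => LinearMap.congr_fun hτ y
  obtain ⟨e, he, hee⟩ := exists_isIdempotentElem_end_lift hnil (ebar := τ ∘ₗ qbar)
    (LinearMap.ext fun y => congrArg τ (hτ' (qbar y)))
  have heq : ∀ x : G, Submodule.Quotient.mk (p := J • (⊤ : Submodule R G)) (e x)
      = τ (Submodule.Quotient.mk (q x)) := hee
  have hidem : ∀ x, e (e x) = e x := fun x => LinearMap.congr_fun he x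
  refine ⟨LinearMap.range e, q.domRestrict _, ?_, ?_, ?_⟩
  · refine Module.Projective.of_split (LinearMap.range e).subtype e.rangeRestrict ?_
    refine LinearMap.ext ?_
    rintro ⟨_, x, rfl⟩
    exact Subtype.ext (hidem x)
  · rw [← LinearMap.range_eq_top]
    refine Submodule.eq_top_of_sup_smul_top_of_isNilpotent hnil (top_le_iff.mp ?_)
    intro y _
    obtain ⟨x, rfl⟩ := hq y
    have h1 : Submodule.Quotient.mk (p := J • (⊤ : Submodule R F)) (q (e x))
        = Submodule.Quotient.mk (q x) := by
      have := congrArg qbar (heq x)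
      rw [hτ'] at this
      exact this
    have h2 : q x - q (e x) ∈ J • (⊤ : Submodule R F) := by
      rw [← Submodule.Quotient.eq, h1]
    refine Submodule.mem_sup.mpr ⟨q (e x), ⟨⟨e x, x, rfl⟩, rfl⟩, _, h2, by abel⟩
  · rintro ⟨_, x, rfl⟩ hx
    have hx : q (e x) = 0 := hx
    have h1 : e x ∈ J • (⊤ : Submodule R G) := by
      rw [← Submodule.Quotient.mk_eq_zero, ← hidem x, heq, hx, Submodule.Quotient.mk_zero,
        map_zero]
    have h2 : e.rangeRestrict (e x) ∈ (J • (⊤ : Submodule R G)).map e.rangeRestrict :=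
      ⟨_, h1, rfl⟩
    rw [Submodule.map_smul''] at h2
    have h3 : e.rangeRestrict (e x) = ⟨e x, x, rfl⟩ := Subtype.ext (hidem x)
    rw [← h3]
    exact Submodule.smul_mono le_rfl le_top h2

/-- The kernel `K` of a projective cover `P → F` satisfies `K ≤ J K`: if `F` is exhausted by
projective submodules, the relations witnessing `K ≤ J P` can be moved into `K` by a section of the
cover over a projective submodule of `F`. -/
theorem IsSemiprimaryRing.ker_eq_bot_of_finset_subset_projective [IsSemiprimaryRing R]
    {F : Type v} {P : Type w} [AddCommGroup F] [Module R F] [AddCommGroup P] [Module R P]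
    (h : ∀ s : Finset F, ∃ Q : Submodule R F, (s : Set F) ⊆ Q ∧ Module.Projective R Q)
    (π : P →ₗ[R] F) (hsurj : Function.Surjective π)
    (hker : LinearMap.ker π ≤ Ring.jacobson R • ⊤) : LinearMap.ker π = ⊥ := by
  classical
  refine Submodule.eq_bot_of_le_smul_of_isNilpotent (IsSemiprimaryRing.isNilpotent (R := R)) ?_
  intro k hk
  -- For `x ∈ J P`, all sections of `π` over large enough submodules of `F` move `x`
  -- by an element of `J K`.
  have key : ∀ x ∈ Ring.jacobson R • (⊤ : Submodule R P), ∃ s : Finset F,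
      ∀ (Q : Submodule R F) (σ : Q →ₗ[R] P), (∀ y, π (σ y) = y) → (s : Set F) ⊆ Q →
        ∃ hx : π x ∈ Q, x - σ ⟨π x, hx⟩ ∈ Ring.jacobson R • LinearMap.ker π := by
    intro x hx
    refine Submodule.smul_induction_on hx (fun j hj p _ => ?_) (fun x y hx hy => ?_)
    · refine ⟨{π p}, fun Q σ hσ hs => ?_⟩
      have hp : π p ∈ Q := hs (by simp)
      refine ⟨by rw [map_smul]; exact Q.smul_mem _ hp, ?_⟩
      have : (⟨π (j • p), by rw [map_smul]; exact Q.smul_mem _ hp⟩ : Q) = j • ⟨π p, hp⟩ :=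
        Subtype.ext (by simp)
      rw [this, map_smul, ← smul_sub]
      refine Submodule.smul_mem_smul hj ?_
      rw [LinearMap.mem_ker, map_sub, hσ, sub_self]
    · obtain ⟨s, hs⟩ := hx
      obtain ⟨t, ht⟩ := hy
      refine ⟨s ∪ t, fun Q σ hσ hst => ?_⟩
      rw [Finset.coe_union, Set.union_subset_iff] at hst
      obtain ⟨hx, hx'⟩ := hs Q σ hσ hst.1
      obtain ⟨hy, hy'⟩ := ht Q σ hσ hst.2
      refine ⟨by rw [map_add]; exact Q.add_mem hx hy, ?_⟩
      have : (⟨π (x + y), by rw [map_add]; exact Q.add_mem hx hy⟩ : Q) = ⟨π x, hx⟩ + ⟨π y, hy⟩ :=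
        Subtype.ext (by simp)
      rw [this, map_add, add_sub_add_comm]
      exact Submodule.add_mem _ hx' hy'
  obtain ⟨s, hs⟩ := key k (hker hk)
  obtain ⟨Q, hsQ, hQ⟩ := h s
  obtain ⟨σ, hσ⟩ := Module.projective_lifting_property π Q.subtype hsurj
  obtain ⟨hx, hx'⟩ := hs Q σ (fun y => LinearMap.congr_fun hσ y) hsQ
  have : (⟨π k, hx⟩ : Q) = 0 := Subtype.ext hk
  rwa [this, map_zero, sub_zero] at hx'

theorem IsSemiprimaryRing.projective_of_surjective_of_finset_subset_projective
    [IsSemiprimaryRing R] {F : Type v} {G : Type w} [AddCommGroup F] [Module R F]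
    [AddCommGroup G] [Module R G] [Module.Projective R G]
    (q : G →ₗ[R] F) (hq : Function.Surjective q)
    (h : ∀ s : Finset F, ∃ Q : Submodule R F, (s : Set F) ⊆ Q ∧ Module.Projective R Q) :
    Module.Projective R F := by
  obtain ⟨P, π, hP, hsurj, hker⟩ := IsSemiprimaryRing.exists_projective_cover q hq
  have hbot := IsSemiprimaryRing.ker_eq_bot_of_finset_subset_projective h π hsurj hker
  exact Module.Projective.of_equiv
    (LinearEquiv.ofBijective π ⟨LinearMap.ker_eq_bot.mp hbot, hsurj⟩)

/-- A form of Bass's theorem that flat modules over perfect rings are projective. -/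
theorem IsSemiprimaryRing.projective_of_finset_subset_projective [IsSemiprimaryRing R]
    {F : Type v} [AddCommGroup F] [Module R F]
    (h : ∀ s : Finset F, ∃ Q : Submodule R F, (s : Set F) ⊆ Q ∧ Module.Projective R Q) :
    Module.Projective R F :=
  IsSemiprimaryRing.projective_of_surjective_of_finset_subset_projective
    (Finsupp.linearCombination R (id : F → F)) (Finsupp.linearCombination_id_surjective R F) h

end Semiprimary

/-! ### The functor `Hom(X, -)` -/

section Hom

variable {Λ : Type u} [Ring Λ] {X : Type v} [AddCommGroup X] [Module Λ X]
  {M N : Type w} [AddCommGroup M] [Module Λ M] [AddCommGroup N] [Module Λ N]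

/-- `Hom(X, M)` is a left module over the opposite of the endomorphism ring of `X`, acting by
precomposition. -/
instance homModule : Module (Module.End Λ X)ᵐᵒᵖ (X →ₗ[Λ] M) where
  smul t f := f ∘ₗ t.unop
  one_smul f := LinearMap.comp_id f
  mul_smul s t f := (LinearMap.comp_assoc s.unop t.unop f).symm
  smul_zero t := LinearMap.zero_comp t.unop
  smul_add t f g := LinearMap.add_comp t.unop g f
  add_smul s t f := LinearMap.comp_add s.unop t.unop f
  zero_smul f := LinearMap.comp_zero f

@[simp] theorem homModule_smul_apply (t : (Module.End Λ X)ᵐᵒᵖ) (f : X →ₗ[Λ] M) (x : X) :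
    (t • f) x = f (t.unop x) := rfl

variable (X) in
/-- Postcomposition with `g`, as a linear map `Hom(X, M) → Hom(X, N)`. -/
def homMap (g : M →ₗ[Λ] N) : (X →ₗ[Λ] M) →ₗ[(Module.End Λ X)ᵐᵒᵖ] (X →ₗ[Λ] N) where
  toFun f := g ∘ₗ f
  map_add' f f' := LinearMap.comp_add f f' g
  map_smul' t f := (LinearMap.comp_assoc t.unop f g).symm

theorem homMap_injective {g : M →ₗ[Λ] N} (hg : Function.Injective g) :
    Function.Injective (homMap X g) := fun _ _ h =>
  LinearMap.ext fun x => hg (LinearMap.congr_fun h x)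

variable (X) in
/-- The maps `X → M` with image in `A`. -/
def homSubmodule (A : Submodule Λ M) : Submodule (Module.End Λ X)ᵐᵒᵖ (X →ₗ[Λ] M) where
  carrier := {f | ∀ x, f x ∈ A}
  add_mem' hf hg x := A.add_mem (hf x) (hg x)
  zero_mem' _ := A.zero_mem
  smul_mem' t _ hf x := hf (t.unop x)

/-- `Hom(X, A)` as a submodule of `Hom(X, M)`. -/
def homSubmoduleEquiv (A : Submodule Λ M) :
    (X →ₗ[Λ] A) ≃ₗ[(Module.End Λ X)ᵐᵒᵖ] homSubmodule X A where
  toFun f := ⟨homMap X A.subtype f, fun x => (f x).2⟩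
  map_add' _ _ := rfl
  map_smul' _ _ := rfl
  invFun f := LinearMap.codRestrict A f.1 f.2
  left_inv _ := rfl
  right_inv _ := rfl

variable (Λ X M) in
/-- `M` belongs to `add X`, that is, it is a direct summand of a finite power of `X`: the identity
of `M` is a finite sum of endomorphisms that factor through `X`. -/
def IsInAdd : Prop :=
  ∃ (ι : Type) (_ : Fintype ι) (a : ι → M →ₗ[Λ] X) (b : ι → X →ₗ[Λ] M),
    ∑ i, b i ∘ₗ a i = LinearMap.id

theorem IsInAdd.projective (h : IsInAdd Λ X M) :
    Module.Projective (Module.End Λ X)ᵐᵒᵖ (X →ₗ[Λ] M) := by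
  obtain ⟨ι, _, a, b, hab⟩ := h
  let i : (X →ₗ[Λ] M) →ₗ[(Module.End Λ X)ᵐᵒᵖ] (ι → (Module.End Λ X)ᵐᵒᵖ) :=
    { toFun := fun f k => MulOpposite.op (a k ∘ₗ f)
      map_add' := fun f g => funext fun k => congrArg MulOpposite.op (LinearMap.comp_add f g (a k))
      map_smul' := fun t f => rfl }
  let s : (ι → (Module.End Λ X)ᵐᵒᵖ) →ₗ[(Module.End Λ X)ᵐᵒᵖ] (X →ₗ[Λ] M) :=
    ∑ k, (LinearMap.toSpanSingleton _ _ (b k)) ∘ₗ LinearMap.proj k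
  refine Module.Projective.of_split i s (LinearMap.ext fun f => LinearMap.ext fun x => ?_)
  have := LinearMap.congr_fun hab (f x)
  simpa [s, i, LinearMap.sum_apply] using this

/-- The map `X → M` that factors as `p : X → Λ` followed by `1 ↦ m`. -/
abbrev homThrough (p : X →ₗ[Λ] Λ) (m : M) : X →ₗ[Λ] M := LinearMap.toSpanSingleton Λ M m ∘ₗ p

theorem homThrough_apply_apply (p : X →ₗ[Λ] Λ) (f : X →ₗ[Λ] M) (x : X) :
    homThrough p (f x) = MulOpposite.op (homThrough p x) • f := by
  ext y
  simp

/-- If `Λ` is in `add X` then `X` is a generator. -/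
theorem IsInAdd.mem_of_forall (h : IsInAdd Λ X Λ) {A : Submodule Λ M} {m : M}
    (hm : ∀ (p : X →ₗ[Λ] Λ) (x : X), homThrough p m x ∈ A) : m ∈ A := by
  obtain ⟨ι, _, a, b, hab⟩ := h
  have h1 := LinearMap.congr_fun hab (1 : Λ)
  have : m = ∑ i, homThrough (b i) m (a i 1) := by
    conv_lhs => rw [← one_smul Λ m, ← LinearMap.id_apply (R := Λ) (1 : Λ), ← h1]
    simp [LinearMap.sum_apply, Finset.sum_smul]
  rw [this]
  exact A.sum_mem fun i _ => hm _ _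

theorem IsInAdd.eq_zero_of_forall (h : IsInAdd Λ X Λ) {m : M}
    (hm : ∀ p : X →ₗ[Λ] Λ, homThrough p m = 0) : m = 0 := by
  have : m ∈ (⊥ : Submodule Λ M) := h.mem_of_forall fun p x => by rw [hm p]; rfl
  simpa using this

theorem IsInAdd.exists_ne_zero (h : IsInAdd Λ X Λ) {m : M} (hm : m ≠ 0) :
    ∃ p : X →ₗ[Λ] Λ, homThrough p m ≠ 0 := by
  by_contra! hp
  exact hm (h.eq_zero_of_forall hp)

/-- Let `U` and `U'` be isomorphic simple submodules of `Hom(X, M)` and let `f ∈ U` and `f' ∈ U'`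
correspond to each other. As `X` is a generator, `f` and `f'` have the same kernel, so elements
`f x` and `f' x` have the same annihilator. If `f x` generates a simple submodule, then `f' x` is
in it, and maps `X → Λ → M` with image there lie in `U ⊓ U'`. -/
theorem HasMultiplicityFreeSocle.hom [IsArtinianRing Λ] (hgen : IsInAdd Λ X Λ)
    (h : HasMultiplicityFreeSocle Λ M) :
    HasMultiplicityFreeSocle (Module.End Λ X)ᵐᵒᵖ (X →ₗ[Λ] M) := by
  rw [hasMultiplicityFreeSocle_iff] at h ⊢
  intro U U' hU hU' ⟨φ⟩
  have := IsSimpleModule.nontrivial (Module.End Λ X)ᵐᵒᵖ U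
  obtain ⟨f, hf⟩ := exists_ne (0 : U)
  have hker : ∀ x, f.1 x = 0 ↔ (φ f).1 x = 0 := by
    have key : ∀ (x : X) (p : X →ₗ[Λ] Λ), homThrough p (f.1 x) = 0 ↔
        homThrough p ((φ f).1 x) = 0 := by
      intro x p
      rw [homThrough_apply_apply, homThrough_apply_apply, ← Submodule.coe_smul,
        ← Submodule.coe_smul, ← map_smul, Submodule.coe_eq_zero, Submodule.coe_eq_zero,
        LinearEquiv.map_eq_zero_iff]
    intro x
    constructor <;> intro hx
    · exact hgen.eq_zero_of_forall fun p => (key x p).mp (by rw [hx]; ext; simp)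
    · exact hgen.eq_zero_of_forall fun p => (key x p).mpr (by rw [hx]; ext; simp)
  have hrange : Nontrivial (LinearMap.range f.1) := by
    rw [Submodule.nontrivial_iff_ne_bot, Ne, LinearMap.range_eq_bot]
    exact fun h0 => hf (Subtype.ext h0)
  obtain ⟨S, hS⟩ := IsSemiprimaryRing.exists_isSimpleModule (R := Λ) (LinearMap.range f.1)
  have := IsSimpleModule.nontrivial Λ S
  obtain ⟨⟨⟨s, x, hx⟩, hsS⟩, hs0⟩ := exists_ne (0 : S)
  have hs0 : s ≠ 0 := fun h0 => hs0 (Subtype.ext (Subtype.ext h0))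
  let s' := (φ f).1 x
  have hs0' : s' ≠ 0 := fun h0 => hs0 (hx ▸ (hker x).mpr h0)
  have hann : ∀ r : Λ, r • s = 0 ↔ r • s' = 0 := by
    intro r
    rw [← hx, ← map_smul, ← map_smul]
    exact hker (r • x)
  -- The cyclic submodule generated by `s` is simple, and the one generated by `s'` is isomorphic.
  have hsimple : IsSimpleModule Λ (Λ ∙ s) := by
    have hS' := hS.submodule_map (LinearMap.range f.1).injective_subtype
    have hle : Λ ∙ s ≤ S.map (LinearMap.range f.1).subtype := by
      rw [Submodule.span_singleton_le_iff_mem]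
      exact ⟨_, hsS, rfl⟩
    rw [isSimpleModule_iff_isAtom] at hS' ⊢
    rcases hS'.le_iff.mp hle with h0 | h1
    · exact absurd (Submodule.span_singleton_eq_bot.mp h0) hs0
    · rwa [h1]
  have hkereq : LinearMap.ker (LinearMap.toSpanSingleton Λ M s)
      = LinearMap.ker (LinearMap.toSpanSingleton Λ M s') := by
    ext r
    exact hann r
  have e : (Λ ∙ s) ≃ₗ[Λ] (Λ ∙ s') :=
    (LinearEquiv.ofEq _ _ (LinearMap.range_toSpanSingleton s).symm).trans <|
      (LinearMap.quotKerEquivRange _).symm.trans <|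
      (Submodule.quotEquivOfEq _ _ hkereq).trans <|
      (LinearMap.quotKerEquivRange _).trans <|
      LinearEquiv.ofEq _ _ (LinearMap.range_toSpanSingleton s')
  have hspan := h _ _ hsimple (IsSimpleModule.congr e.symm) ⟨e⟩
  obtain ⟨r, hr⟩ := Submodule.mem_span_singleton.mp
    (hspan ▸ Submodule.mem_span_singleton_self s' : s' ∈ Λ ∙ s)
  obtain ⟨p, hp⟩ := hgen.exists_ne_zero hs0'
  have hmem' : homThrough p s' ∈ U' := by
    rw [homThrough_apply_apply]
    exact U'.smul_mem _ (φ f).2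
  have hmem : homThrough p s' ∈ U := by
    rw [← hr, ← hx, ← map_smul, homThrough_apply_apply]
    exact U.smul_mem _ f.2
  by_contra hne
  have hdisj := (isSimpleModule_iff_isAtom.mp hU).disjoint_of_ne
    (isSimpleModule_iff_isAtom.mp hU') hne
  exact hp (Submodule.disjoint_def.mp hdisj _ hmem hmem')

/-- If a simple module `S` embeds in `M` in two ways, a simple submodule of `Hom(X, S)` embeds in
`Hom(X, M)` in two ways. -/
theorem HasMultiplicityFreeSocle.of_hom [IsSemiprimaryRing (Module.End Λ X)ᵐᵒᵖ]
    (hgen : IsInAdd Λ X Λ) (h : HasMultiplicityFreeSocle (Module.End Λ X)ᵐᵒᵖ (X →ₗ[Λ] M)) :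
    HasMultiplicityFreeSocle Λ M := by
  rw [hasMultiplicityFreeSocle_iff]
  intro S S' hS hS' ⟨θ⟩
  have := IsSimpleModule.nontrivial Λ S
  have hnt : Nontrivial (X →ₗ[Λ] S) := by
    obtain ⟨s, hs⟩ := exists_ne (0 : S)
    obtain ⟨p, hp⟩ := hgen.exists_ne_zero hs
    exact nontrivial_of_ne _ _ hp
  obtain ⟨U, hU⟩ := IsSemiprimaryRing.exists_isSimpleModule (R := (Module.End Λ X)ᵐᵒᵖ)
    (X →ₗ[Λ] S)
  have heq := h.map_eq_map (homMap_injective (X := X) S.injective_subtype)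
    (homMap_injective (g := S'.subtype ∘ₗ θ.toLinearMap)
      (S'.injective_subtype.comp θ.injective)) hU
  have := IsSimpleModule.nontrivial (Module.End Λ X)ᵐᵒᵖ U
  obtain ⟨f, hf⟩ := exists_ne (0 : U)
  obtain ⟨g, -, hg⟩ : homMap X S.subtype f.1 ∈
      U.map (homMap X (S'.subtype ∘ₗ θ.toLinearMap)) := heq ▸ ⟨f.1, f.2, rfl⟩
  obtain ⟨x, hx⟩ : ∃ x, f.1 x ≠ 0 := by
    by_contra! h0
    exact hf (Subtype.ext (LinearMap.ext h0))
  by_contra hne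
  have hdisj := (isSimpleModule_iff_isAtom.mp hS).disjoint_of_ne
    (isSimpleModule_iff_isAtom.mp hS') hne
  refine hx (Subtype.ext (Submodule.disjoint_def.mp hdisj _ (f.1 x).2 ?_))
  have := LinearMap.congr_fun hg x
  have h2 : ((θ (g x) : S') : M) = (f.1 x : M) := this
  rw [← h2]
  exact (θ (g x)).2

/-- The elements `m` of `M` such that all maps `X → Λ → M` through `m` are in `A`. -/
def homTrace (A : Submodule (Module.End Λ X)ᵐᵒᵖ (X →ₗ[Λ] M)) : Submodule Λ M where
  carrier := {m | ∀ p : X →ₗ[Λ] Λ, homThrough p m ∈ A}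
  add_mem' {m m'} hm hm' p := by
    have : homThrough p (m + m') = homThrough p m + homThrough p m' := by ext; simp
    rw [this]
    exact A.add_mem (hm p) (hm' p)
  zero_mem' p := by
    have : homThrough p (0 : M) = 0 := by ext; simp
    rw [this]
    exact A.zero_mem
  smul_mem' r m hm p := by
    have : homThrough p (r • m) = homThrough (homThrough p r) m := by ext; simp [mul_smul]
    rw [this]
    exact hm _

theorem apply_mem_homTrace {A : Submodule (Module.End Λ X)ᵐᵒᵖ (X →ₗ[Λ] M)} {f : X →ₗ[Λ] M}
    (hf : f ∈ A) (x : X) : f x ∈ homTrace A := fun p => by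
  rw [homThrough_apply_apply]
  exact A.smul_mem _ hf

theorem IsIndecomposableModule.hom (hgen : IsInAdd Λ X Λ) (h : IsIndecomposableModule Λ M) :
    IsIndecomposableModule (Module.End Λ X)ᵐᵒᵖ (X →ₗ[Λ] M) := by
  obtain ⟨hnt, hind⟩ := h
  refine ⟨?_, fun A B hAB => ?_⟩
  · obtain ⟨m, hm⟩ := exists_ne (0 : M)
    obtain ⟨p, hp⟩ := hgen.exists_ne_zero hm
    exact nontrivial_of_ne _ _ hp
  have hcompl : IsCompl (homTrace A) (homTrace B) := by
    refine ⟨Submodule.disjoint_def.mpr fun m hA hB => ?_, codisjoint_iff.mpr <|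
      top_le_iff.mp fun m _ => ?_⟩
    · exact hgen.eq_zero_of_forall fun p =>
        Submodule.disjoint_def.mp hAB.disjoint _ (hA p) (hB p)
    · refine hgen.mem_of_forall fun p x => ?_
      have : homThrough p m ∈ A ⊔ B := hAB.sup_eq_top ▸ trivial
      obtain ⟨a, ha, b, hb, hab⟩ := Submodule.mem_sup.mp this
      rw [← hab]
      exact Submodule.add_mem_sup (apply_mem_homTrace ha x) (apply_mem_homTrace hb x)
  refine (hind _ _ hcompl).imp (fun h0 => ?_) (fun h0 => ?_) <;>
  · refine (Submodule.eq_bot_iff _).mpr fun f hf => LinearMap.ext fun x => ?_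
    simpa [h0] using apply_mem_homTrace hf x

theorem IsIndecomposableModule.of_hom (hgen : IsInAdd Λ X Λ)
    (h : IsIndecomposableModule (Module.End Λ X)ᵐᵒᵖ (X →ₗ[Λ] M)) :
    IsIndecomposableModule Λ M := by
  obtain ⟨hnt, hind⟩ := h
  refine ⟨?_, fun A B hAB => ?_⟩
  · by_contra hM
    rw [not_nontrivial_iff_subsingleton] at hM
    exact not_subsingleton (X →ₗ[Λ] M) inferInstance
  have hcompl : IsCompl (homSubmodule X A) (homSubmodule X B) := by
    refine ⟨Submodule.disjoint_def.mpr fun f hA hB => LinearMap.ext fun x =>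
      Submodule.disjoint_def.mp hAB.disjoint _ (hA x) (hB x), codisjoint_iff.mpr <|
      top_le_iff.mp fun f _ => ?_⟩
    refine Submodule.mem_sup.mpr ⟨A.subtype ∘ₗ A.projectionOnto B hAB ∘ₗ f, fun x => by simp,
      B.subtype ∘ₗ B.projectionOnto A hAB.symm ∘ₗ f, fun x => by simp, ?_⟩
    ext x
    exact Submodule.projection_add_projection_eq_self hAB (f x)
  refine (hind _ _ hcompl).imp (fun h0 => ?_) (fun h0 => ?_) <;>
  · refine (Submodule.eq_bot_iff _).mpr fun a ha => hgen.eq_zero_of_forall fun p => ?_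
    have : homThrough p a ∈ (⊥ : Submodule (Module.End Λ X)ᵐᵒᵖ (X →ₗ[Λ] M)) :=
      h0 ▸ fun x => Submodule.smul_mem _ _ ha
    simpa using this

theorem IsIndecomposableModule.congr {R : Type*} [Ring R] {M N : Type*} [AddCommGroup M]
    [Module R M] [AddCommGroup N] [Module R N] (e : M ≃ₗ[R] N) (h : IsIndecomposableModule R M) :
    IsIndecomposableModule R N := by
  obtain ⟨hnt, hind⟩ := h
  refine ⟨e.symm.toEquiv.nontrivial, fun A B hAB => ?_⟩
  refine (hind _ _ ((Submodule.orderIsoMapComap e).symm.isCompl hAB)).imp (fun h0 => ?_)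
    (fun h0 => ?_) <;>
  · exact (Submodule.orderIsoMapComap e).symm.injective (h0.trans (OrderIso.map_bot _).symm)

end Hom

/-! ### Projective modules over endomorphism rings -/

section Projective

variable {Λ : Type u} [Ring Λ] {X : Type v} [AddCommGroup X] [Module Λ X]

variable (Λ X) in
/-- The canonical map `⊕ T → Hom(X, ⊕ X)`, where `T` is the opposite of the endomorphism ring. -/
noncomputable def finsuppHom (ι : Type w) :
    (ι →₀ (Module.End Λ X)ᵐᵒᵖ) →ₗ[(Module.End Λ X)ᵐᵒᵖ] (X →ₗ[Λ] (ι →₀ X)) :=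
  Finsupp.linearCombination _ fun i => (Finsupp.lsingle i : X →ₗ[Λ] (ι →₀ X))

theorem finsuppHom_single {ι : Type w} (i : ι) (t : (Module.End Λ X)ᵐᵒᵖ) :
    finsuppHom Λ X ι (Finsupp.single i t) = t • Finsupp.lsingle i :=
  Finsupp.linearCombination_single _ _ _

theorem finsuppHom_apply_apply {ι : Type w} (g : ι →₀ (Module.End Λ X)ᵐᵒᵖ) (x : X) (i : ι) :
    finsuppHom Λ X ι g x i = (g i).unop x := by
  classical
  induction g using Finsupp.induction_linear with
  | zero => simp
  | add g h hg hh => simp [hg, hh]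
  | single j t =>
    rw [finsuppHom_single, homModule_smul_apply, Finsupp.lsingle_apply, Finsupp.single_apply,
      Finsupp.single_apply]
    split_ifs <;> simp

theorem finsuppHom_injective (ι : Type w) : Function.Injective (finsuppHom Λ X ι) := by
  intro g h hgh
  ext i : 1
  refine MulOpposite.unop_injective (LinearMap.ext fun x => ?_)
  rw [← finsuppHom_apply_apply, ← finsuppHom_apply_apply, hgh]

/-- Maps from a finitely generated module to `⊕ X` factor through a finite subsum. -/
theorem finsuppHom_surjective [Module.Finite Λ X] (ι : Type w) :
    Function.Surjective (finsuppHom Λ X ι) := by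
  classical
  intro f
  obtain ⟨S, hS⟩ := Module.Finite.fg_top (R := Λ) (M := X)
  let s : Finset ι := S.biUnion fun x => (f x).support
  have hs : (⊤ : Submodule Λ X) ≤ (Finsupp.supported X Λ (s : Set ι)).comap f := by
    rw [← hS, Submodule.span_le]
    intro x hx
    rw [SetLike.mem_coe, Submodule.mem_comap, Finsupp.mem_supported]
    exact_mod_cast Finset.subset_biUnion_of_mem (fun x => (f x).support) hx
  refine ⟨Finsupp.indicator s fun i _ => MulOpposite.op (Finsupp.lapply i ∘ₗ f), ?_⟩
  ext x i
  rw [finsuppHom_apply_apply, Finsupp.indicator_apply]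
  split_ifs with hi
  · rfl
  · have hx : f x ∈ Finsupp.supported X Λ (s : Set ι) := hs (Submodule.mem_top (x := x))
    rw [Finsupp.mem_supported] at hx
    have : i ∉ (f x).support := fun h => hi (hx h)
    simpa using (Finsupp.notMem_support_iff.mp this).symm

/-- The functor `Hom(X, -)` is full on maps out of sums of copies of `X`. -/
theorem exists_homMap_finsuppHom {ι : Type w} {N : Type*} [AddCommGroup N] [Module Λ N]
    (α : (ι →₀ (Module.End Λ X)ᵐᵒᵖ) →ₗ[(Module.End Λ X)ᵐᵒᵖ] (X →ₗ[Λ] N)) :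
    ∃ a : (ι →₀ X) →ₗ[Λ] N, ∀ g, a ∘ₗ finsuppHom Λ X ι g = α g := by
  refine ⟨Finsupp.lsum ℕ fun i => α (Finsupp.single i 1), fun g => ?_⟩
  induction g using Finsupp.induction_linear with
  | zero => ext; simp
  | add g h hg hh => rw [map_add, map_add, LinearMap.comp_add, hg, hh]
  | single i t =>
    have : α (Finsupp.single i t) = t • α (Finsupp.single i 1) := by
      rw [← map_smul, Finsupp.smul_single, smul_eq_mul, mul_one]
    rw [this, finsuppHom_single]
    ext x
    simp

/-- A projective module is the image of an idempotent endomorphism of a free module; the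
corresponding idempotent endomorphism of a sum of copies of `X` has the required image. -/
theorem exists_linearEquiv_hom_of_projective [Module.Finite Λ X] (P : Type w) [AddCommGroup P]
    [Module (Module.End Λ X)ᵐᵒᵖ P] [Module.Projective (Module.End Λ X)ᵐᵒᵖ P] :
    ∃ M : Submodule Λ (P →₀ X), Nonempty (P ≃ₗ[(Module.End Λ X)ᵐᵒᵖ] (X →ₗ[Λ] M)) := by
  obtain ⟨s, hs⟩ := Module.projective_def'.mp
    (inferInstance : Module.Projective (Module.End Λ X)ᵐᵒᵖ P)
  set π := Finsupp.linearCombination (Module.End Λ X)ᵐᵒᵖ (id : P → P)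
  have hs' : ∀ p, π (s p) = p := fun p => LinearMap.congr_fun hs p
  obtain ⟨ε, hε⟩ := exists_homMap_finsuppHom (finsuppHom Λ X P ∘ₗ s ∘ₗ π)
  have hε' : ∀ g, ε ∘ₗ finsuppHom Λ X P g = finsuppHom Λ X P (s (π g)) := hε
  have hidem : ε ∘ₗ ε = ε := by
    refine Finsupp.lhom_ext' fun p => ?_
    have h1 : (Finsupp.lsingle p : X →ₗ[Λ] (P →₀ X))
        = finsuppHom Λ X P (Finsupp.single p 1) := by
      rw [finsuppHom_single, one_smul]
    rw [h1, LinearMap.comp_assoc, hε', hε', hs']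
  let Ψ : P →ₗ[(Module.End Λ X)ᵐᵒᵖ] (X →ₗ[Λ] (P →₀ X)) := finsuppHom Λ X P ∘ₗ s
  have hΨ : Function.Injective Ψ :=
    (finsuppHom_injective P).comp (Function.LeftInverse.injective hs')
  have hrange : LinearMap.range Ψ = homSubmodule X (LinearMap.range ε) := by
    ext f
    constructor
    · rintro ⟨p, rfl⟩ x
      refine ⟨Ψ p x, ?_⟩
      have := LinearMap.congr_fun (hε' (s p)) x
      rwa [hs'] at this
    · intro hf
      obtain ⟨g, rfl⟩ := finsuppHom_surjective P f
      refine ⟨π g, ?_⟩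
      have : ε ∘ₗ finsuppHom Λ X P g = finsuppHom Λ X P g := by
        ext x : 1
        obtain ⟨y, hy⟩ := hf x
        rw [LinearMap.comp_apply, ← hy]
        exact LinearMap.congr_fun hidem y
      rw [← this, hε']
      rfl
  exact ⟨LinearMap.range ε, ⟨(LinearEquiv.ofInjective Ψ hΨ).trans <|
    (LinearEquiv.ofEq _ _ hrange).trans (homSubmoduleEquiv _).symm⟩⟩

/-- If `add X` contains all finitely generated modules, then `Hom(X, M)` is the directed union of
the projective modules `Hom(X, A)` with `A` a finitely generated submodule of `M`. -/
theorem projective_hom_of_forall_isInAdd [Module.Finite Λ X]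
    [IsSemiprimaryRing (Module.End Λ X)ᵐᵒᵖ] {M : Type w} [AddCommGroup M] [Module Λ M]
    (h : ∀ A : Submodule Λ M, A.FG → IsInAdd Λ X A) :
    Module.Projective (Module.End Λ X)ᵐᵒᵖ (X →ₗ[Λ] M) := by
  refine IsSemiprimaryRing.projective_of_finset_subset_projective fun s => ?_
  let A : Submodule Λ M := s.sup fun f => LinearMap.range f
  have hA : A.FG := Submodule.fg_finset_sup s _ fun f _ => by
    rw [← Submodule.map_top]; exact Module.Finite.fg_top.map f
  refine ⟨homSubmodule X A, fun f hf x => ?_, ?_⟩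
  · exact Finset.le_sup (f := fun f : X →ₗ[Λ] M => LinearMap.range f) hf ⟨x, rfl⟩
  · have := (h A hA).projective
    exact Module.Projective.of_equiv (homSubmoduleEquiv A)

end Projective

/-! ### Decompositions of modules of finite length -/

section Add

variable {Λ : Type u} [Ring Λ] {X : Type v} [AddCommGroup X] [Module Λ X]
  {M : Type w} [AddCommGroup M] [Module Λ M]

theorem IsInAdd.of_leftInverse (a : M →ₗ[Λ] X) (b : X →ₗ[Λ] M) (h : b ∘ₗ a = LinearMap.id) :
    IsInAdd Λ X M :=
  ⟨Unit, inferInstance, fun _ => a, fun _ => b, by simpa using h⟩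

theorem IsInAdd.congr {N : Type*} [AddCommGroup N] [Module Λ N] (e : M ≃ₗ[Λ] N)
    (h : IsInAdd Λ X M) : IsInAdd Λ X N := by
  obtain ⟨ι, _, a, b, hab⟩ := h
  refine ⟨ι, inferInstance, fun i => a i ∘ₗ e.symm.toLinearMap,
    fun i => e.toLinearMap ∘ₗ b i, ?_⟩
  ext y
  have := congrArg e (LinearMap.congr_fun hab (e.symm y))
  simpa [LinearMap.sum_apply] using this

theorem IsInAdd.of_subsingleton [Subsingleton M] : IsInAdd Λ X M :=
  ⟨Empty, inferInstance, Empty.elim, Empty.elim, LinearMap.ext fun _ => Subsingleton.elim _ _⟩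

theorem IsInAdd.of_isCompl {A B : Submodule Λ M} (h : IsCompl A B) (hA : IsInAdd Λ X A)
    (hB : IsInAdd Λ X B) : IsInAdd Λ X M := by
  obtain ⟨ι, _, a, b, hab⟩ := hA
  obtain ⟨κ, _, c, d, hcd⟩ := hB
  refine ⟨ι ⊕ κ, inferInstance,
    Sum.elim (fun i => a i ∘ₗ A.projectionOnto B h) (fun k => c k ∘ₗ B.projectionOnto A h.symm),
    Sum.elim (fun i => A.subtype ∘ₗ b i) (fun k => B.subtype ∘ₗ d k), ?_⟩
  ext x
  have h1 := congrArg A.subtype (LinearMap.congr_fun hab (A.projectionOnto B h x))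
  have h2 := congrArg B.subtype (LinearMap.congr_fun hcd (B.projectionOnto A h.symm x))
  simp only [LinearMap.sum_apply, map_sum, LinearMap.comp_apply, LinearMap.id_apply] at h1 h2
  simp only [Fintype.sum_sum_type, LinearMap.add_apply, LinearMap.sum_apply, Sum.elim_inl,
    Sum.elim_inr, LinearMap.comp_apply, LinearMap.id_apply, h1, h2]
  exact Submodule.projection_add_projection_eq_self h x

theorem IsInAdd.of_forall_indecomposable [IsArtinian Λ M]
    (h : ∀ A : Submodule Λ M, IsIndecomposableModule Λ A → IsInAdd Λ X A) : IsInAdd Λ X M := by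
  suffices ∀ A : Submodule Λ M, IsInAdd Λ X A from (this ⊤).congr Submodule.topEquiv
  intro A
  induction A using WellFoundedLT.induction with
  | ind A ih =>
    rcases subsingleton_or_nontrivial A with hA | hA
    · exact .of_subsingleton
    by_cases hind : IsIndecomposableModule Λ A
    · exact h A hind
    obtain ⟨B, C, hBC, hB, hC⟩ : ∃ B C : Submodule Λ A, IsCompl B C ∧ B ≠ ⊥ ∧ C ≠ ⊥ := by
      by_contra! hcon
      exact hind ⟨hA, fun B C hBC => or_iff_not_imp_left.mpr (hcon B C hBC)⟩
    have key : ∀ B C : Submodule Λ A, IsCompl B C → C ≠ ⊥ → IsInAdd Λ X B := by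
      intro B C hBC hC
      have hlt : B.map A.subtype < A := by
        refine lt_of_le_of_ne (Submodule.map_subtype_le A B) fun heq => hC ?_
        have : B = ⊤ := by
          refine Submodule.map_injective_of_injective A.injective_subtype ?_
          rw [heq, Submodule.map_subtype_top]
        exact le_bot_iff.mp ((le_inf (this ▸ le_top) le_rfl).trans hBC.disjoint.le_bot)
      exact (ih _ hlt).congr
        (Submodule.equivMapOfInjective A.subtype A.injective_subtype B).symm
    exact .of_isCompl hBC (key B C hBC hC) (key C B hBC.symm hB)

end Add

/-! ### Non-isomorphisms between indecomposable modules -/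

section NonIso

variable {Λ : Type u} [Ring Λ] {L M N : Type*} [AddCommGroup L] [Module Λ L]
  [AddCommGroup M] [Module Λ M] [AddCommGroup N] [Module Λ N]

theorem IsIndecomposableModule.bijective_of_comp (hL : Nontrivial L)
    (hM : IsIndecomposableModule Λ M) {f : L →ₗ[Λ] M} {g : M →ₗ[Λ] N}
    (h : Function.Bijective (g ∘ₗ f)) : Function.Bijective f ∧ Function.Bijective g := by
  rw [LinearMap.coe_comp] at h
  have hcompl : IsCompl (LinearMap.range f) (LinearMap.ker g) := by
    refine ⟨Submodule.disjoint_def.mpr ?_, codisjoint_iff.mpr (top_le_iff.mp fun x _ => ?_)⟩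
    · rintro _ ⟨y, rfl⟩ hy
      have : y = 0 := h.1 (by simpa using hy)
      rw [this, map_zero]
    · obtain ⟨y, hy⟩ := h.2 (g x)
      refine Submodule.mem_sup.mpr ⟨f y, ⟨y, rfl⟩, x - f y, ?_, by abel⟩
      rw [LinearMap.mem_ker, map_sub, sub_eq_zero]
      exact hy.symm
  have hf : Function.Injective f := Function.Injective.of_comp h.1
  have hker : LinearMap.ker g = ⊥ := by
    refine (hM.2 _ _ hcompl).resolve_left fun h0 => ?_
    obtain ⟨y, hy⟩ := exists_ne (0 : L)
    rw [LinearMap.range_eq_bot] at h0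
    exact hy (hf (by rw [h0]; rfl))
  have hg : Function.Bijective g :=
    ⟨LinearMap.ker_eq_bot.mp hker, Function.Surjective.of_comp h.2⟩
  exact ⟨(Function.Bijective.of_comp_iff' hg _).mp h, hg⟩

/-- Fitting's lemma. -/
theorem IsIndecomposableModule.bijective_or_isNilpotent [IsArtinian Λ M] [IsNoetherian Λ M]
    (hM : IsIndecomposableModule Λ M) (f : Module.End Λ M) :
    Function.Bijective f ∨ IsNilpotent f := by
  obtain ⟨n, hn, hn0⟩ := (f.eventually_isCompl_ker_pow_range_pow.and
    (Filter.eventually_ge_atTop 1)).exists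
  rcases hM.2 _ _ hn with h0 | h0
  · left
    refine (IsArtinian.bijective_of_injective_endomorphism f ?_)
    have : Function.Injective (f ^ n) := LinearMap.ker_eq_bot.mp h0
    obtain ⟨m, rfl⟩ : ∃ m, n = m + 1 := ⟨n - 1, by omega⟩
    rw [pow_succ] at this
    exact Function.Injective.of_comp this
  · exact .inr ⟨n, LinearMap.range_eq_bot.mp h0⟩

/-- The endomorphism ring of an indecomposable module of finite length is local. -/
theorem IsIndecomposableModule.bijective_of_add [IsArtinian Λ M] [IsNoetherian Λ M]
    (hM : IsIndecomposableModule Λ M) {f g : M →ₗ[Λ] N} (h : Function.Bijective (f + g)) :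
    Function.Bijective f ∨ Function.Bijective g := by
  let e := LinearEquiv.ofBijective (f + g) h
  have hcomp : ∀ k : M →ₗ[Λ] N, Function.Bijective (e.symm.toLinearMap ∘ₗ k) →
      Function.Bijective k := fun k hk =>
    (Function.Bijective.of_comp_iff' e.symm.bijective k).mp hk
  let f' : Module.End Λ M := e.symm.toLinearMap ∘ₗ f
  let g' : Module.End Λ M := e.symm.toLinearMap ∘ₗ g
  have hsum : g' = 1 - f' := by
    rw [eq_sub_iff_add_eq', ← LinearMap.comp_add]
    exact LinearMap.ext fun x => e.symm_apply_apply x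
  rcases hM.bijective_or_isNilpotent f' with hf | hf
  · exact .inl (hcomp f hf)
  · right
    have hu : IsUnit g' := hsum ▸ hf.isUnit_one_sub
    exact hcomp g ((Module.End.isUnit_iff _).mp hu)

variable (N) in
/-- The homomorphisms from an indecomposable module `M` of finite length that are not
isomorphisms. -/
def nonIsoHom [IsArtinian Λ M] [IsNoetherian Λ M] (hM : IsIndecomposableModule Λ M) :
    AddSubmonoid (M →ₗ[Λ] N) where
  carrier := {f | ¬ Function.Bijective f}
  add_mem' hf hg h := (hM.bijective_of_add h).elim hf hg
  zero_mem' h := by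
    obtain ⟨x, hx⟩ := @exists_ne M hM.1 0
    exact hx (h.1 rfl)

/-- The step of the Harada–Sai lemma: if two maps have images of the same finite length as their
composite through a third map `g` between indecomposable modules, and that composite is nonzero,
then `g` is an isomorphism. -/
theorem bijective_of_length_range_le {L' : Type*} [AddCommGroup L'] [Module Λ L']
    [IsArtinian Λ L'] [IsNoetherian Λ L'] (hM : IsIndecomposableModule Λ M)
    (hN : IsIndecomposableModule Λ N) {f : L →ₗ[Λ] M} {g : M →ₗ[Λ] N} {h : N →ₗ[Λ] L'}
    (h0 : h ∘ₗ g ∘ₗ f ≠ 0)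
    (hf : Module.length Λ (LinearMap.range f) ≤ Module.length Λ (LinearMap.range (h ∘ₗ g ∘ₗ f)))
    (hh : Module.length Λ (LinearMap.range h) ≤ Module.length Λ (LinearMap.range (h ∘ₗ g ∘ₗ f))) :
    Function.Bijective g := by
  have hle : LinearMap.range (h ∘ₗ g ∘ₗ f) ≤ LinearMap.range h := LinearMap.range_comp_le_range _ _
  have hrange : LinearMap.range (h ∘ₗ g ∘ₗ f) = LinearMap.range h := by
    rw [Module.length_submodule, Module.length_submodule] at hh
    by_contra hne
    exact (Submodule.height_strictMono (lt_of_le_of_ne hle hne)).not_ge hh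
  -- `h ∘ g` is injective on the image of `f`.
  have hinj : ∀ x, h (g (f x)) = 0 → f x = 0 := by
    let φ : LinearMap.range f →ₗ[Λ] LinearMap.range (h ∘ₗ g ∘ₗ f) :=
      LinearMap.codRestrict _ ((h ∘ₗ g).domRestrict _) (by rintro ⟨_, x, rfl⟩; exact ⟨x, rfl⟩)
    have hφ : Function.Surjective φ := by
      rintro ⟨_, x, rfl⟩
      exact ⟨⟨f x, x, rfl⟩, rfl⟩
    have hlen := Module.length_eq_add_of_exact (LinearMap.ker φ).subtype φ
      (Submodule.subtype_injective _) hφ (LinearMap.exact_subtype_ker_map φ)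
    have hfin : Module.length Λ (LinearMap.range (h ∘ₗ g ∘ₗ f)) ≠ ⊤ := Module.length_ne_top
    rw [hlen] at hf
    have hzero : Module.length Λ (LinearMap.ker φ) = 0 := by
      have h1 : Module.length Λ (LinearMap.ker φ) +
          Module.length Λ (LinearMap.range (h ∘ₗ g ∘ₗ f)) ≤
          0 + Module.length Λ (LinearMap.range (h ∘ₗ g ∘ₗ f)) := by rwa [zero_add]
      exact le_antisymm ((ENat.add_le_add_iff_right hfin).mp h1) zero_le
    rw [Module.length_eq_zero_iff, Submodule.subsingleton_iff_eq_bot, LinearMap.ker_eq_bot] at hzero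
    intro x hx
    have : (⟨f x, x, rfl⟩ : LinearMap.range f) = 0 :=
      hzero (Subtype.ext (by rw [map_zero]; exact hx))
    exact congrArg Subtype.val this
  have hf0 : LinearMap.range f ≠ ⊥ := fun hbot => h0 <| by
    rw [LinearMap.range_eq_bot.mp hbot, LinearMap.comp_zero, LinearMap.comp_zero]
  have hgf0 : LinearMap.range (g ∘ₗ f) ≠ ⊥ := fun hbot => h0 <| by
    rw [LinearMap.range_eq_bot.mp hbot, LinearMap.comp_zero]
  have hM' : IsCompl (LinearMap.range f) (LinearMap.ker (h ∘ₗ g)) := by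
    refine ⟨Submodule.disjoint_def.mpr ?_, codisjoint_iff.mpr (top_le_iff.mp fun x _ => ?_)⟩
    · rintro _ ⟨y, rfl⟩ hy
      exact hinj y hy
    · obtain ⟨y, hy⟩ : h (g x) ∈ LinearMap.range (h ∘ₗ g ∘ₗ f) := hrange ▸ ⟨g x, rfl⟩
      refine Submodule.mem_sup.mpr ⟨f y, ⟨y, rfl⟩, x - f y, ?_, by abel⟩
      rw [LinearMap.mem_ker, map_sub, sub_eq_zero]
      exact hy.symm
  have hN' : IsCompl (LinearMap.range (g ∘ₗ f)) (LinearMap.ker h) := by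
    refine ⟨Submodule.disjoint_def.mpr ?_, codisjoint_iff.mpr (top_le_iff.mp fun x _ => ?_)⟩
    · rintro _ ⟨y, rfl⟩ hy
      rw [LinearMap.comp_apply, hinj y hy, map_zero]
    · obtain ⟨y, hy⟩ : h x ∈ LinearMap.range (h ∘ₗ g ∘ₗ f) := hrange ▸ ⟨x, rfl⟩
      refine Submodule.mem_sup.mpr ⟨g (f y), ⟨y, rfl⟩, x - g (f y), ?_, by abel⟩
      rw [LinearMap.mem_ker, map_sub, sub_eq_zero]
      exact hy.symm
  have hk1 : LinearMap.ker (h ∘ₗ g) = ⊥ := (hM.2 _ _ hM').resolve_left hf0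
  have hk2 : LinearMap.ker h = ⊥ := (hN.2 _ _ hN').resolve_left hgf0
  refine ⟨Function.Injective.of_comp (f := h) (LinearMap.ker_eq_bot.mp hk1), ?_⟩
  have htop : LinearMap.range (g ∘ₗ f) = ⊤ := by simpa [hk2] using hN'.sup_eq_top
  exact Function.Surjective.of_comp (g := f) (LinearMap.range_eq_top.mp htop)

end NonIso

section HaradaSai

variable {Λ : Type u} [Ring Λ] {ι : Type*} {X : ι → Type v}
  [∀ i, AddCommGroup (X i)] [∀ i, Module Λ (X i)]

variable (Λ X) in
/-- Composites of `2 ^ m - 1` non-isomorphisms, interspersed with arbitrary maps. -/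
def nonIsoComp : ℕ → ∀ i j : ι, Set (X i →ₗ[Λ] X j)
  | 0, _, _ => Set.univ
  | m + 1, i, j => {f | ∃ (k l : ι) (a : X i →ₗ[Λ] X k) (g : X k →ₗ[Λ] X l) (b : X l →ₗ[Λ] X j),
      a ∈ nonIsoComp m i k ∧ ¬ Function.Bijective g ∧ b ∈ nonIsoComp m l j ∧ f = b ∘ₗ g ∘ₗ a}

/-- The Harada–Sai lemma: if a composite of `2 ^ m - 1` non-isomorphisms between indecomposable
modules of length at most `b` is nonzero, its image has length at most `b - m`. -/
theorem eq_zero_or_length_add_le_of_mem_nonIsoComp [∀ i, IsArtinian Λ (X i)]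
    [∀ i, IsNoetherian Λ (X i)] (hX : ∀ i, IsIndecomposableModule Λ (X i)) {b : ℕ∞}
    (hb : ∀ i, Module.length Λ (X i) ≤ b) (m : ℕ) {i j : ι} {f : X i →ₗ[Λ] X j}
    (hf : f ∈ nonIsoComp Λ X m i j) :
    f = 0 ∨ Module.length Λ (LinearMap.range f) + m ≤ b := by
  induction m generalizing i j with
  | zero =>
    right
    rw [Nat.cast_zero, add_zero]
    exact (Module.length_le_of_injective _ (LinearMap.range f).injective_subtype).trans (hb j)
  | succ m ih =>
    obtain ⟨k, l, p, g, q, hp, hg, hq, rfl⟩ := hf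
    by_contra! hcon
    obtain ⟨h0, hlt⟩ := hcon
    have hle : b ≤ Module.length Λ (LinearMap.range (q ∘ₗ g ∘ₗ p)) + m := by
      rw [Nat.cast_add, Nat.cast_one, ← add_assoc] at hlt
      exact Order.le_of_lt_add_one hlt
    have hp0 : p ≠ 0 := by rintro rfl; simp at h0
    have hq0 : q ≠ 0 := by rintro rfl; simp at h0
    have hm : (m : ℕ∞) ≠ ⊤ := ENat.natCast_ne_top m
    exact hg <| bijective_of_length_range_le (hX k) (hX l) h0
      ((ENat.add_le_add_iff_right hm).mp (((ih hp).resolve_left hp0).trans hle))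
      ((ENat.add_le_add_iff_right hm).mp (((ih hq).resolve_left hq0).trans hle))

end HaradaSai

/-! ### The endomorphism ring of a direct sum of indecomposable modules -/

section DirectSumEnd

variable {Λ : Type u} [Ring Λ] {ι : Type*} [DecidableEq ι] {X : ι → Type v}
  [∀ i, AddCommGroup (X i)] [∀ i, Module Λ (X i)]

/-- The component `X i → X j` of an endomorphism of `⨁ i, X i`. -/
def entry (t : Module.End Λ (⨁ i, X i)) (i j : ι) : X i →ₗ[Λ] X j :=
  DirectSum.component Λ ι X j ∘ₗ t ∘ₗ DirectSum.lof Λ ι X i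

theorem entry_add (s t : Module.End Λ (⨁ i, X i)) (i j : ι) :
    entry (s + t) i j = entry s i j + entry t i j := by
  ext; simp [entry]

theorem sum_lof_component [Fintype ι] (x : ⨁ i, X i) :
    ∑ k, DirectSum.lof Λ ι X k (DirectSum.component Λ ι X k x) = x :=
  DirectSum.sum_univ_of x

theorem entry_mul [Fintype ι] (s t : Module.End Λ (⨁ i, X i)) (i j : ι) :
    entry (s * t) i j = ∑ k, entry s k j ∘ₗ entry t i k := by
  ext x
  simp only [entry, LinearMap.comp_apply, LinearMap.sum_apply, Module.End.mul_apply, ← map_sum]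
  rw [sum_lof_component]

/-- The endomorphism of `⨁ i, X i` with only one component `X i → X j`. -/
def ofEntry {i j : ι} (f : X i →ₗ[Λ] X j) : Module.End Λ (⨁ i, X i) :=
  DirectSum.lof Λ ι X j ∘ₗ f ∘ₗ DirectSum.component Λ ι X i

theorem eq_zero_of_entry {t : Module.End Λ (⨁ i, X i)} (h : ∀ i j, entry t i j = 0) : t = 0 := by
  refine DirectSum.linearMap_ext _ fun i => LinearMap.ext fun x => ?_
  refine DirectSum.ext_component Λ fun j => ?_
  simpa [entry] using LinearMap.congr_fun (h i j) x

section Radical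

variable [Fintype ι] [∀ i, IsArtinian Λ (X i)] [∀ i, IsNoetherian Λ (X i)]
  (hX : ∀ i, IsIndecomposableModule Λ (X i))

/-- The endomorphisms of `⨁ i, X i` that have no isomorphism among their components. This
is the Jacobson radical, see `jacobson_eq_nonIsoIdeal`. -/
def nonIsoIdeal : Ideal (Module.End Λ (⨁ i, X i))ᵐᵒᵖ where
  carrier := {t | ∀ i j, entry t.unop i j ∈ nonIsoHom (X j) (hX i)}
  add_mem' {s t} hs ht i j := by
    rw [MulOpposite.unop_add, entry_add]
    exact AddSubmonoid.add_mem _ (hs i j) (ht i j)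
  zero_mem' i j := by
    have : entry (0 : Module.End Λ (⨁ i, X i)) i j = 0 := by ext; simp [entry]
    rw [MulOpposite.unop_zero, this]
    exact AddSubmonoid.zero_mem _
  smul_mem' s t ht i j := by
    rw [smul_eq_mul, MulOpposite.unop_mul, entry_mul]
    exact AddSubmonoid.sum_mem _ fun k _ h =>
      ht k j ((hX k).bijective_of_comp (hX i).1 h).2

theorem mem_nonIsoIdeal {t : (Module.End Λ (⨁ i, X i))ᵐᵒᵖ} :
    t ∈ nonIsoIdeal hX ↔ ∀ i j, ¬ Function.Bijective (entry t.unop i j) := Iff.rfl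

instance : (nonIsoIdeal hX).IsTwoSided where
  mul_mem_of_left {t} s ht i j := by
    rw [MulOpposite.unop_mul, entry_mul]
    exact AddSubmonoid.sum_mem _ fun k _ h =>
      ht i k ((hX k).bijective_of_comp (hX i).1 h).1

/-- The exponent `n` constructed here is `2 ^ m - 1`. -/
theorem exists_forall_entry_mem_closure (m : ℕ) : ∃ n : ℕ, ∀ t ∈ nonIsoIdeal hX ^ n, ∀ i j,
    entry t.unop i j ∈ AddSubmonoid.closure (nonIsoComp Λ X m i j) := by
  induction m with
  | zero => exact ⟨0, fun t _ i j => AddSubmonoid.subset_closure trivial⟩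
  | succ m ih =>
    obtain ⟨n, hn⟩ := ih
    have hcomp : ∀ (i k l j : ι) (a : X i →ₗ[Λ] X k) (g : X k →ₗ[Λ] X l) (b : X l →ₗ[Λ] X j),
        a ∈ AddSubmonoid.closure (nonIsoComp Λ X m i k) → ¬ Function.Bijective g →
        b ∈ AddSubmonoid.closure (nonIsoComp Λ X m l j) →
        b ∘ₗ g ∘ₗ a ∈ AddSubmonoid.closure (nonIsoComp Λ X (m + 1) i j) := by
      intro i k l j a g b ha hg hb
      induction ha using AddSubmonoid.closure_induction with
      | zero => simp
      | add a a' _ _ h h' =>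
        rw [LinearMap.comp_add, LinearMap.comp_add]
        exact AddSubmonoid.add_mem _ h h'
      | mem a ha =>
        induction hb using AddSubmonoid.closure_induction with
        | zero => simp
        | add b b' _ _ h h' =>
          rw [LinearMap.add_comp]
          exact AddSubmonoid.add_mem _ h h'
        | mem b hb =>
          exact AddSubmonoid.subset_closure ⟨k, l, a, g, b, ha, hg, hb, rfl⟩
    refine ⟨n + (n + 1), fun t ht i j => ?_⟩
    rw [Ideal.IsTwoSided.pow_add] at ht
    refine Submodule.smul_induction_on ht (fun r hr s hs => ?_) (fun x y hx hy => ?_)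
    · rw [Ideal.IsTwoSided.pow_succ] at hs
      refine Submodule.smul_induction_on hs (fun c hc d hd => ?_) (fun x y hx hy => ?_)
      · rw [smul_eq_mul, smul_eq_mul, MulOpposite.unop_mul, MulOpposite.unop_mul, entry_mul]
        refine AddSubmonoid.sum_mem _ fun k _ => ?_
        have hsum : ∀ (c' : ι → X k →ₗ[Λ] X j) (a : X i →ₗ[Λ] X k),
            (∑ l, c' l) ∘ₗ a = ∑ l, c' l ∘ₗ a := fun c' a => by ext; simp [LinearMap.sum_apply]
        rw [entry_mul, hsum]
        refine AddSubmonoid.sum_mem _ fun l _ => ?_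
        rw [LinearMap.comp_assoc]
        exact hcomp _ _ _ _ _ _ _ (hn r hr i k) (hc k l) (hn d hd l j)
      · rw [smul_add, MulOpposite.unop_add, entry_add]
        exact AddSubmonoid.add_mem _ hx hy
    · rw [MulOpposite.unop_add, entry_add]
      exact AddSubmonoid.add_mem _ hx hy

theorem isNilpotent_nonIsoIdeal : IsNilpotent (nonIsoIdeal hX) := by
  let b : ℕ∞ := ∑ i, Module.length Λ (X i)
  have hb : ∀ i, Module.length Λ (X i) ≤ b := fun i =>
    Finset.single_le_sum (f := fun i => Module.length Λ (X i)) (fun _ _ => zero_le)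
      (Finset.mem_univ i)
  obtain ⟨m, hm⟩ : ∃ m : ℕ, b < m := by
    have hbtop : b ≠ ⊤ := by
      refine (ENat.sum_ne_top).mpr fun i _ => Module.length_ne_top
    obtain ⟨c, hc⟩ := ENat.ne_top_iff_exists.mp hbtop
    exact ⟨c + 1, by rw [← hc]; exact_mod_cast Nat.lt_succ_self c⟩
  obtain ⟨n, hn⟩ := exists_forall_entry_mem_closure hX m
  refine ⟨n, (Submodule.eq_bot_iff _).mpr fun t ht => ?_⟩
  refine MulOpposite.unop_injective (eq_zero_of_entry fun i j => ?_)
  have hle : AddSubmonoid.closure (nonIsoComp Λ X m i j) ≤ ⊥ := by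
    rw [AddSubmonoid.closure_le]
    intro f hf
    refine (eq_zero_or_length_add_le_of_mem_nonIsoComp hX hb m hf).resolve_right fun h => ?_
    exact (hm.trans_le (le_add_self.trans h)).false
  exact hle (hn t ht i j)

/-- If the component `X k → X i` of `t` is an isomorphism, composing `t` with maps built from the
inverse of that component gives back the projection onto `X i`. So that projection generates a simple module modulo the ideal of the
endomorphisms without isomorphisms among their components. -/
theorem isSimpleModule_span_mk_ofEntry (i : ι) :
    IsSimpleModule (Module.End Λ (⨁ i, X i))ᵐᵒᵖ
      (Submodule.span (Module.End Λ (⨁ i, X i))ᵐᵒᵖ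
        {(nonIsoIdeal hX).mkQ (MulOpposite.op (ofEntry (LinearMap.id : X i →ₗ[Λ] X i)))}) := by
  set e : (Module.End Λ (⨁ i, X i))ᵐᵒᵖ := MulOpposite.op (ofEntry (LinearMap.id : X i →ₗ[Λ] X i))
  rw [isSimpleModule_iff_isAtom]
  refine ⟨fun hbot => ?_, fun B hB => ?_⟩
  · rw [Submodule.span_singleton_eq_bot, Submodule.mkQ_apply, Submodule.Quotient.mk_eq_zero] at hbot
    refine hbot i i ?_
    have : entry e.unop i i = LinearMap.id := by
      ext x
      simp [entry, e, ofEntry, DirectSum.component.lof_self]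
    rw [this]
    exact Function.bijective_id
  · by_contra hne
    obtain ⟨y, hyB, hy0⟩ := Submodule.exists_mem_ne_zero_of_ne_bot hne
    obtain ⟨t, rfl⟩ := Submodule.mem_span_singleton.mp (hB.le hyB)
    rw [← map_smul, Submodule.mkQ_apply, Ne, Submodule.Quotient.mk_eq_zero, mem_nonIsoIdeal] at hy0
    push Not at hy0
    obtain ⟨k, j, hkj⟩ := hy0
    have hentry : entry (t • e).unop k j
        = DirectSum.component Λ ι X j ∘ₗ DirectSum.lof Λ ι X i ∘ₗ entry t.unop k i := rfl
    have hij : i = j := by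
      by_contra hij
      obtain ⟨x, hx⟩ := @exists_ne _ (hX k).1 0
      refine hx (hkj.1 ?_)
      rw [hentry, map_zero, LinearMap.comp_apply, LinearMap.comp_apply, DirectSum.component.of,
        dif_neg hij]
    subst hij
    have hentry' : entry (t • e).unop k i = entry t.unop k i := by
      rw [hentry]
      ext x
      simp [DirectSum.component.lof_self]
    rw [hentry'] at hkj
    let u := LinearEquiv.ofBijective _ hkj
    let v : (Module.End Λ (⨁ i, X i))ᵐᵒᵖ := MulOpposite.op (ofEntry u.symm.toLinearMap)
    have hv : v • t • e = e := by
      refine MulOpposite.unop_injective (LinearMap.ext fun x => ?_)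
      exact congrArg (DirectSum.lof Λ ι X i)
        (u.apply_symm_apply (DirectSum.component Λ ι X i x))
    refine hB.not_ge ?_
    rw [Submodule.span_singleton_le_iff_mem, ← hv, map_smul, map_smul]
    exact B.smul_mem _ hyB

theorem isSemisimpleModule_quotient_nonIsoIdeal :
    IsSemisimpleModule (Module.End Λ (⨁ i, X i))ᵐᵒᵖ
      ((Module.End Λ (⨁ i, X i))ᵐᵒᵖ ⧸ nonIsoIdeal hX) := by
  refine .of_sSup_simples_eq_top (top_le_iff.mp fun y _ => ?_)
  obtain ⟨t, rfl⟩ := Submodule.mkQ_surjective _ y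
  have ht : t = ∑ i, t • MulOpposite.op (ofEntry (LinearMap.id : X i →ₗ[Λ] X i)) := by
    rw [← Finset.smul_sum, ← Finset.op_sum]
    have : ∑ i, ofEntry (LinearMap.id : X i →ₗ[Λ] X i) = 1 := by
      refine LinearMap.ext fun x => ?_
      rw [LinearMap.sum_apply]
      exact sum_lof_component x
    rw [this, MulOpposite.op_one, smul_eq_mul, mul_one]
  rw [ht, map_sum]
  refine Submodule.sum_mem _ fun i _ => ?_
  rw [map_smul]
  exact Submodule.smul_mem _ _ <| le_sSup (a := Submodule.span _ _)
    (isSimpleModule_span_mk_ofEntry hX i) (Submodule.mem_span_singleton_self _)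

theorem jacobson_eq_nonIsoIdeal :
    Ring.jacobson (Module.End Λ (⨁ i, X i))ᵐᵒᵖ = nonIsoIdeal hX := by
  refine le_antisymm ?_ ?_
  · have := isSemisimpleModule_quotient_nonIsoIdeal hX
    exact (IsSemisimpleModule.jacobson_le_ker _ _ _ _ (nonIsoIdeal hX).mkQ).trans
      (Submodule.ker_mkQ _).le
  · rw [Ring.jacobson_eq_sInf_isMaximal]
    refine le_sInf fun m hm => ?_
    by_contra hle
    have hsup : m ⊔ nonIsoIdeal hX = ⊤ := (Ideal.isMaximal_def.mp hm).2 _ (left_lt_sup.mpr hle)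
    refine hm.ne_top (Submodule.eq_top_of_sup_smul_top_of_isNilpotent
      (isNilpotent_nonIsoIdeal hX) (top_le_iff.mp ?_))
    refine hsup.ge.trans (sup_le_sup_left (fun t ht => ?_) m)
    rw [← mul_one t, ← smul_eq_mul]
    exact Submodule.smul_mem_smul ht trivial

include hX in
/-- The endomorphism ring of a finite direct sum of indecomposable modules of finite length is
semiprimary. -/
theorem isSemiprimaryRing_end_directSum : IsSemiprimaryRing (Module.End Λ (⨁ i, X i))ᵐᵒᵖ where
  isNilpotent := jacobson_eq_nonIsoIdeal hX ▸ isNilpotent_nonIsoIdeal hX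
  isSemisimpleRing := by
    have h := isSemisimpleModule_quotient_nonIsoIdeal hX
    rw [← jacobson_eq_nonIsoIdeal hX] at h
    exact (LinearMap.isSemisimpleModule_iff_of_bijective
      (σ := Ideal.Quotient.mk (Ring.jacobson (Module.End Λ (⨁ i, X i))ᵐᵒᵖ))
      { toFun := id, map_add' := fun _ _ => rfl, map_smul' := fun r x => rfl }
      Function.bijective_id).mp h

end Radical

end DirectSumEnd

/-! ### Rings of finite representation type -/

theorem IsCompleteSetOfFGIndecomposables.isInAdd {Λ : Type u} [Ring Λ] [IsArtinianRing Λ] {n : ℕ}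
    {X : Fin n → ModuleCat.{u} Λ} (hX : IsCompleteSetOfFGIndecomposables X) (M : Type u)
    [AddCommGroup M] [Module Λ M] [Module.Finite Λ M] : IsInAdd Λ (⨁ i, X i) M := by
  refine IsInAdd.of_forall_indecomposable fun A hA => ?_
  obtain ⟨i, ⟨e⟩⟩ := hX.exists_iso A inferInstance hA
  refine IsInAdd.of_leftInverse (DirectSum.lof Λ (Fin n) (fun i => X i) i ∘ₗ e.toLinearMap)
    (e.symm.toLinearMap ∘ₗ DirectSum.component Λ (Fin n) (fun i => X i) i) ?_
  ext x
  simp [DirectSum.component.lof_self]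

theorem proposition2 (Λ : Type u) [Ring Λ] (hΛ : IsOfFiniteRepresentationType Λ)
    (n : ℕ) (X : Fin n → ModuleCat.{u} Λ) (hX : IsCompleteSetOfFGIndecomposables X) :
    IsGeneralizedLeftQF2 (AuslanderRing X) ↔
      ∀ (M : Type u) [AddCommGroup M] [Module Λ M],
        IsIndecomposableModule Λ M → HasMultiplicityFreeSocle Λ M := by
  have := hΛ.1
  have := hX.finite
  have hgen : IsInAdd Λ (⨁ i, X i) Λ := hX.isInAdd Λ
  have hsp : IsSemiprimaryRing (Module.End Λ (⨁ i, X i))ᵐᵒᵖ :=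
    isSemiprimaryRing_end_directSum hX.indecomposable
  constructor
  · rintro ⟨-, h⟩ M _ _ hM
    refine HasMultiplicityFreeSocle.of_hom hgen (h _ ?_ (hM.hom hgen))
    refine projective_hom_of_forall_isInAdd fun A hA => ?_
    have : Module.Finite Λ A := Module.Finite.iff_fg.mpr hA
    exact hX.isInAdd A
  · intro h
    refine ⟨hsp.isSemiperfectRing, fun P _ _ hP hind => ?_⟩
    obtain ⟨M, ⟨e⟩⟩ := exists_linearEquiv_hom_of_projective (Λ := Λ) (X := ⨁ i, X i) P
    have hM : IsIndecomposableModule Λ M := (hind.congr e).of_hom hgen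
    exact ((h M hM).hom hgen).of_injective e.toLinearMap e.injective
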